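/- Let $A\subseteq \mathbb B(H)$ be a von Neumann algebra on a complex Hilbert space $H$. Let $$\ell^2(A)=\Big\{(a_n)_n : a_n\in A,\ \sum_{n} a_na_n^*\text{ converges in norm}\Big\},\qquad \langle (a_n)_n,(b_n)_n\rangle=\sum_n a_nb_n^*\ \text{(norm convergence)},$$ be the standard Hilbert $A$-module, and let $$\ell^2_{\mathrm{strong}}(A)=\Big\{(c_n)_n : c_n\in A,\ \sup_N\Big\|\sum_{n=1}^N c_nc_n^*\Big\|<\infty\Big\},$$ both with the left action $a\cdot(c_n)_n=(ac_n)_n$ and the norm $\|x\|=\|\langle x,x\rangle\|^{1/2}$, where the inner product on $\ell^2_{\mathrm{strong}}(A)$ is $$\langle (x_n)_n,(y_n)_n\rangle=(\text{strong})\sum_{n} x_ny_n^*\in A,$$ the series converging in the strong operator topology. For a Hilbert $A$-module $X$ let $X'$ be the Banach space of all bounded linear maps $L:X\to A$ with $L(ax)=aL(x)$ for $a\in A$, $x\in X$, with the operator norm; $X$ is called self-dual if every $L\in X'$ is of the form $y\mapsto\langle y,x\rangle$ for some $x\in X$. Then $\ell^2_{\mathrm{strong}}(A)$ is a (complete) Hilbert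 $A$-module which contains $\ell^2(A)$ and whose inner product extends that of $\ell^2(A)$. The map $$\varphi:\ell^2_{\mathrm{strong}}(A)\to \ell^2(A)',\qquad \varphi((t_n)_n)\big((a_n)_n\big)=\sum_n a_nt_n^*=\langle (a_n)_n,(t_n)_n\rangle\quad\text{(norm convergence)},$$ is an anti-linear isometric isomorphism onto $\ell^2(A)'$; it satisfies $\varphi(bt)(a)=\varphi(t)(a)\,b^*$ for $b\in A$, and on $\ell^2(A)$ it is the canonical embedding $\varphi(b)(a)=\langle a,b\rangle$ of $\ell^2(A)$ into $\ell^2(A)'$. Moreover, $\ell^2_{\mathrm{strong}}(A)$ is self-dual. -/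

import Mathlib

open Filter Topology

noncomputable section

/-! ### Modules over a C⋆-algebra: the dual and self-duality

`CStarModule` is Mathlib's class of inner product modules over a C⋆-algebra: the scalars act on the
left, and `inner A x y` is linear in the *second* variable.  With the convention
(linear in the first variable, antilinear in the second) one has `⟨x, y⟩ = inner A y x`. -/

/-- The dual `E'`: the space of all bounded module maps `L : E → A`, that is, bounded linear maps
with `L (a • x) = a * L x`, with the operator norm. -/
def CStarDual (A E : Type*) [NormedRing A] [NormedAlgebra ℂ A] [NormedAddCommGroup E]
    [NormedSpace ℂ E] [Module A E] : Submodule ℂ (E →L[ℂ] A) where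
  carrier := {L | ∀ (a : A) (x : E), L (a • x) = a * L x}
  add_mem' hL hM a x := by simp [hL a x, hM a x, mul_add]
  zero_mem' a x := by simp
  smul_mem' c L hL a x := by simp [hL a x]

/-- `E` is self-dual: every bounded module map `L : E → A` is of the form `y ↦ ⟨y, x⟩`. -/
def IsSelfDualModule (A E : Type*) [NormedRing A] [NormedAlgebra ℂ A] [StarRing A]
    [PartialOrder A] [NormedAddCommGroup E] [NormedSpace ℂ E] [Module A E] [CStarModule A E] :
    Prop :=
  ∀ L ∈ CStarDual A E, ∃ x : E, ∀ y : E, L y = inner A x y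

namespace VonNeumannAlgebra

variable {H : Type*} [NormedAddCommGroup H] [InnerProductSpace ℂ H] [CompleteSpace H]
variable (A : VonNeumannAlgebra H)

/-- The von Neumann algebra `A` as a type, with the operations, the operator norm and the operator
order inherited from the bounded operators on `H`. -/
abbrev Elem : Type _ := ↥A.toStarSubalgebra

theorem norm_coe (a : A.Elem) : ‖(a : H →L[ℂ] H)‖ = ‖a‖ := rfl

theorem coe_sum_mul_star (x y : ℕ → A.Elem) (N : ℕ) :
    ((∑ n ∈ Finset.range N, x n * star (y n) : A.Elem) : H →L[ℂ] H) =
      ∑ n ∈ Finset.range N, (x n : H →L[ℂ] H) * star (y n : H →L[ℂ] H) := by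
  simp

theorem norm_smul_clm {E F : Type*} [NormedAddCommGroup E] [NormedSpace ℂ E]
    [NormedAddCommGroup F] [NormedSpace ℂ F] (c : ℂ) (f : E →L[ℂ] F) : ‖c • f‖ = ‖c‖ * ‖f‖ :=
  norm_smul c f

/-! ### The space of sequences `ℓ²_strong(A)` -/

/-- The sequences `(cₙ)` in `A` with `sup_N ‖∑_{n<N} cₙ cₙ*‖ < ∞`, as a left `A`-submodule of the
module of all sequences. -/
def strongSeq : Submodule A.Elem (ℕ → A.Elem) where
  carrier := {c | BddAbove (Set.range fun N : ℕ => ‖∑ n ∈ Finset.range N, c n * star (c n)‖)}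
  zero_mem' := ⟨0, by rintro _ ⟨N, rfl⟩; simp⟩
  add_mem' := by
    rintro x y ⟨C, hC⟩ ⟨D, hD⟩
    refine ⟨2 * (C + D), ?_⟩
    rintro _ ⟨N, rfl⟩
    beta_reduce
    have h1 : ‖∑ n ∈ Finset.range N, x n * star (x n)‖ ≤ C := hC ⟨N, rfl⟩
    have h2 : ‖∑ n ∈ Finset.range N, y n * star (y n)‖ ≤ D := hD ⟨N, rfl⟩
    rw [← norm_coe, coe_sum_mul_star] at h1 h2 ⊢
    have key : ∑ n ∈ Finset.range N, (((x + y) n : A.Elem) : H →L[ℂ] H) *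
          star (((x + y) n : A.Elem) : H →L[ℂ] H) ≤
        (2 : ℝ) • (∑ n ∈ Finset.range N, (x n : H →L[ℂ] H) * star (x n : H →L[ℂ] H) +
          ∑ n ∈ Finset.range N, (y n : H →L[ℂ] H) * star (y n : H →L[ℂ] H)) := by
      rw [← Finset.sum_add_distrib, Finset.smul_sum]
      refine Finset.sum_le_sum fun n _ => ?_
      rw [← sub_nonneg]
      have := mul_star_self_nonneg ((x n : H →L[ℂ] H) - (y n : H →L[ℂ] H))
      convert this using 1
      simp only [Pi.add_apply, AddMemClass.coe_add, star_add, star_sub, two_smul]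
      noncomm_ring
    have h0 : 0 ≤ ∑ n ∈ Finset.range N, (((x + y) n : A.Elem) : H →L[ℂ] H) *
          star (((x + y) n : A.Elem) : H →L[ℂ] H) :=
      Finset.sum_nonneg fun n _ => mul_star_self_nonneg _
    refine (CStarAlgebra.norm_le_norm_of_nonneg_of_le h0 key).trans ?_
    rw [norm_smul, Real.norm_ofNat]
    gcongr
    exact (norm_add_le _ _).trans (add_le_add h1 h2)
  smul_mem' := by
    rintro a x ⟨C, hC⟩
    refine ⟨‖a‖ * C * ‖star a‖, ?_⟩
    rintro _ ⟨N, rfl⟩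
    have h1 : ‖∑ n ∈ Finset.range N, x n * star (x n)‖ ≤ C := hC ⟨N, rfl⟩
    have : ∑ n ∈ Finset.range N, (a • x) n * star ((a • x) n) =
        a * (∑ n ∈ Finset.range N, x n * star (x n)) * star a := by
      simp [Finset.mul_sum, Finset.sum_mul, mul_assoc]
    simp only [this]
    refine (norm_mul_le _ _).trans ?_
    gcongr
    refine (norm_mul_le _ _).trans ?_
    gcongr

/-- `ℓ²_strong(A)`, the type of all sequences `(cₙ)` in `A` with
`sup_N ‖∑_{n<N} cₙ cₙ*‖ < ∞`. -/
def EllStrong : Type _ := ↥A.strongSeq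

namespace EllStrong

instance : AddCommGroup A.EllStrong := inferInstanceAs (AddCommGroup ↥A.strongSeq)
instance : Module A.Elem A.EllStrong := inferInstanceAs (Module A.Elem ↥A.strongSeq)
instance : Module ℂ A.EllStrong := inferInstanceAs (Module ℂ ↥A.strongSeq)

variable {A}

/-- The underlying sequence; `x n` is its `n`-th term. -/
def seq (x : A.EllStrong) : ℕ → A.Elem := Subtype.val (p := (· ∈ A.strongSeq)) x

instance : CoeFun A.EllStrong (fun _ => ℕ → A.Elem) := ⟨seq⟩

@[ext] theorem ext {x y : A.EllStrong} (h : ∀ n, x n = y n) : x = y := Subtype.ext (funext h)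
@[simp] theorem add_apply (x y : A.EllStrong) (n : ℕ) : (x + y) n = x n + y n := rfl
@[simp] theorem zero_apply (n : ℕ) : (0 : A.EllStrong) n = 0 := rfl
@[simp] theorem smul_apply (a : A.Elem) (x : A.EllStrong) (n : ℕ) : (a • x) n = a * x n := rfl
@[simp] theorem csmul_apply (c : ℂ) (x : A.EllStrong) (n : ℕ) : (c • x) n = c • x n := rfl
@[simp] theorem sub_apply (x y : A.EllStrong) (n : ℕ) : (x - y) n = x n - y n := rfl

theorem exists_sum_norm_sq_le (x : A.EllStrong) : ∃ C : ℝ, 0 ≤ C ∧ ∀ (ξ : H) (s : Finset ℕ),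
    ∑ n ∈ s, ‖star (x n : H →L[ℂ] H) ξ‖ ^ 2 ≤ C * ‖ξ‖ ^ 2 := by
  obtain ⟨C, hC⟩ : BddAbove (Set.range fun N : ℕ =>
    ‖∑ n ∈ Finset.range N, x n * star (x n)‖) := Subtype.property (p := (· ∈ A.strongSeq)) x
  refine ⟨C, (norm_nonneg _).trans (hC ⟨0, rfl⟩), fun ξ s => ?_⟩
  obtain ⟨N, hN⟩ := s.exists_nat_subset_range
  have h1 : ‖∑ n ∈ Finset.range N, x n * star (x n)‖ ≤ C := hC ⟨N, rfl⟩
  rw [← norm_coe, coe_sum_mul_star] at h1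
  have h2 : ∑ n ∈ Finset.range N, ‖star (x n : H →L[ℂ] H) ξ‖ ^ 2 =
      RCLike.re (inner ℂ ξ ((∑ n ∈ Finset.range N,
        (x n : H →L[ℂ] H) * star (x n : H →L[ℂ] H)) ξ)) := by
    simp only [_root_.sum_apply, inner_sum, map_sum]
    refine Finset.sum_congr rfl fun n _ => ?_
    rw [_root_.mul_apply_eq_comp, ← ContinuousLinearMap.adjoint_inner_left,
      ← ContinuousLinearMap.star_eq_adjoint, inner_self_eq_norm_sq]
  calc ∑ n ∈ s, ‖star (x n : H →L[ℂ] H) ξ‖ ^ 2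
      ≤ ∑ n ∈ Finset.range N, ‖star (x n : H →L[ℂ] H) ξ‖ ^ 2 :=
        Finset.sum_le_sum_of_subset_of_nonneg hN fun _ _ _ => by positivity
    _ ≤ ‖ξ‖ * (C * ‖ξ‖) := by
        rw [h2]
        refine (re_inner_le_norm _ _).trans ?_
        gcongr
        refine (ContinuousLinearMap.le_opNorm _ _).trans ?_
        gcongr
    _ = C * ‖ξ‖ ^ 2 := by ring

theorem memlp_row (x : A.EllStrong) (ξ : H) :
    Memℓp (fun n => star (x n : H →L[ℂ] H) ξ) 2 := by
  obtain ⟨C, hC0, hC⟩ := exists_sum_norm_sq_le x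
  refine memℓp_gen' (C := C * ‖ξ‖ ^ 2) fun s => ?_
  simpa using hC ξ s

/-- Auxiliary: the bounded operator `ξ ↦ (xₙ* ξ)ₙ` from `H` to `ℓ²(ℕ, H)`. -/
def row (x : A.EllStrong) : H →L[ℂ] lp (fun _ : ℕ => H) 2 :=
  LinearMap.mkContinuousOfExistsBound
    { toFun := fun ξ => ⟨fun n => star (x n : H →L[ℂ] H) ξ, memlp_row x ξ⟩
      map_add' := fun ξ η => by ext n; exact map_add _ _ _
      map_smul' := fun c ξ => by ext n; exact map_smul _ _ _ }
    (by
      obtain ⟨C, hC0, hC⟩ := exists_sum_norm_sq_le x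
      refine ⟨√C, fun ξ => lp.norm_le_of_forall_sum_le (by simp) (by positivity) fun s => ?_⟩
      have := hC ξ s
      simpa [mul_pow, Real.sq_sqrt hC0] using this)

@[simp] theorem row_apply (x : A.EllStrong) (ξ : H) (n : ℕ) :
    row x ξ n = star (x n : H →L[ℂ] H) ξ := rfl

theorem row_add (x y : A.EllStrong) : row (x + y) = row x + row y := by
  ext ξ n; simp

theorem row_smul (a : A.Elem) (x : A.EllStrong) :
    row (a • x) = row x ∘L (star (a : H →L[ℂ] H)) := by
  ext ξ n; simp

theorem row_csmul (c : ℂ) (x : A.EllStrong) : row (c • x) = star c • row x := by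
  ext ξ n; simp

theorem row_eq_zero {x : A.EllStrong} : row x = 0 ↔ x = 0 := by
  constructor
  · intro h
    refine ext fun n => ?_
    have : star (x n : H →L[ℂ] H) = 0 := by
      ext ξ
      rw [← row_apply, h]; rfl
    exact Subtype.ext (star_eq_zero.mp this)
  · rintro rfl
    ext ξ n; simp

theorem adjoint_row_single (x : A.EllStrong) (n : ℕ) (v : H) :
    (row x).adjoint (lp.single 2 n v) = (x n : H →L[ℂ] H) v := by
  refine ext_inner_left ℂ fun η => ?_
  rw [ContinuousLinearMap.adjoint_inner_right, lp.inner_single_right, row_apply,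
    ContinuousLinearMap.star_eq_adjoint, ContinuousLinearMap.adjoint_inner_left]

theorem hasSum_row (x y : A.EllStrong) (ξ : H) :
    HasSum (fun n => (x n : H →L[ℂ] H) (star (y n : H →L[ℂ] H) ξ))
      (((row x).adjoint ∘L row y) ξ) := by
  have h := (lp.hasSum_single (E := fun _ : ℕ => H) (p := 2) (by simp) (row y ξ)).mapL
    (row x).adjoint
  simpa [adjoint_row_single] using h

theorem adjoint_row_comp_row_mem (x y : A.EllStrong) :
    (row x).adjoint ∘L row y ∈ A.toStarSubalgebra := by
  rw [mem_carrier, ← A.centralizer_centralizer, Set.mem_centralizer_iff]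
  intro g hg
  rw [Set.mem_centralizer_iff] at hg
  refine ContinuousLinearMap.ext fun ξ => ?_
  have h1 := (hasSum_row x y ξ).mapL g
  have h2 := hasSum_row x y (g ξ)
  have he : (fun n => g ((x n : H →L[ℂ] H) (star (y n : H →L[ℂ] H) ξ))) =
      fun n => (x n : H →L[ℂ] H) (star (y n : H →L[ℂ] H) (g ξ)) := ?_
  · rw [he] at h1
    exact h1.unique h2
  funext n
  have hx : (x n : H →L[ℂ] H) * g = g * x n := hg _ (x n).2
  have hy : star (y n : H →L[ℂ] H) * g = g * star (y n : H →L[ℂ] H) := hg _ (star (y n)).2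
  have := congrArg (fun T : H →L[ℂ] H => T ξ)
    (show g * ((x n : H →L[ℂ] H) * star (y n : H →L[ℂ] H)) =
      (x n : H →L[ℂ] H) * star (y n : H →L[ℂ] H) * g by
        rw [mul_assoc, hy, ← mul_assoc, ← mul_assoc, hx])
  simpa using this

/-- For `x, y ∈ ℓ²_strong(A)` the series `∑ xₙ yₙ*` converges in the strong operator topology, to
an element of `A`. -/
theorem exists_strong_sum (x y : A.EllStrong) : ∃ s : A.Elem, ∀ ξ : H,
    Tendsto (fun N : ℕ => ((∑ n ∈ Finset.range N, x n * star (y n) : A.Elem) : H →L[ℂ] H) ξ)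
      atTop (𝓝 ((s : H →L[ℂ] H) ξ)) := by
  refine ⟨⟨_, adjoint_row_comp_row_mem x y⟩, fun ξ => ?_⟩
  simpa [_root_.sum_apply] using (hasSum_row x y ξ).tendsto_sum_nat

/-- `⟨x, y⟩ = (strong) ∑ xₙ yₙ*`: the element of `A` to which the partial sums of this series
converge in the strong operator topology. It is linear in `x` and antilinear in `y`. -/
def strongInner (x y : A.EllStrong) : A.Elem := (exists_strong_sum x y).choose

theorem tendsto_strongInner (x y : A.EllStrong) (ξ : H) :
    Tendsto (fun N : ℕ => ((∑ n ∈ Finset.range N, x n * star (y n) : A.Elem) : H →L[ℂ] H) ξ)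
      atTop (𝓝 ((strongInner x y : H →L[ℂ] H) ξ)) :=
  (exists_strong_sum x y).choose_spec ξ

theorem coe_strongInner (x y : A.EllStrong) :
    (strongInner x y : H →L[ℂ] H) = (row x).adjoint ∘L row y := by
  ext ξ
  refine tendsto_nhds_unique (tendsto_strongInner x y ξ) ?_
  simpa [_root_.sum_apply] using (hasSum_row x y ξ).tendsto_sum_nat

/-- The norm `‖x‖ = ‖⟨x, x⟩‖^{1/2}`. -/
instance : Norm A.EllStrong := ⟨fun x => √‖strongInner x x‖⟩

theorem norm_def (x : A.EllStrong) : ‖x‖ = √‖strongInner x x‖ := rfl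

theorem norm_eq_norm_row (x : A.EllStrong) : ‖x‖ = ‖row x‖ := by
  rw [norm_def, ← norm_coe, coe_strongInner,
    ContinuousLinearMap.norm_adjoint_comp_self, Real.sqrt_mul_self (norm_nonneg _)]

theorem normedSpaceCore : NormedSpace.Core ℂ A.EllStrong where
  norm_nonneg _ := Real.sqrt_nonneg _
  norm_eq_zero_iff x := by
    rw [norm_eq_norm_row, ContinuousLinearMap.opNorm_zero_iff, row_eq_zero]
  norm_smul c x := by
    rw [norm_eq_norm_row, norm_eq_norm_row, row_csmul, ← norm_star c]
    exact norm_smul_clm (star c) (row x)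
  norm_triangle x y := by
    simp only [norm_eq_norm_row, row_add]
    exact norm_add_le (row x) (row y)

instance : NormedAddCommGroup A.EllStrong := NormedAddCommGroup.ofCore normedSpaceCore
instance : NormedSpace ℂ A.EllStrong := NormedSpace.ofCore normedSpaceCore

theorem norm_strongInner_le (x y : A.EllStrong) : ‖strongInner x y‖ ≤ ‖x‖ * ‖y‖ := by
  rw [← norm_coe, coe_strongInner, norm_eq_norm_row, norm_eq_norm_row]
  refine (ContinuousLinearMap.opNorm_comp_le _ _).trans ?_
  simp

theorem strongInner_add_left (x y z : A.EllStrong) :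
    strongInner (x + y) z = strongInner x z + strongInner y z := by
  apply Subtype.ext
  rw [AddMemClass.coe_add, coe_strongInner, coe_strongInner, coe_strongInner, row_add, map_add,
    ContinuousLinearMap.add_comp]

theorem star_strongInner (x y : A.EllStrong) : star (strongInner x y) = strongInner y x := by
  apply Subtype.ext
  rw [StarMemClass.coe_star, coe_strongInner, coe_strongInner,
    ContinuousLinearMap.star_eq_adjoint, ContinuousLinearMap.adjoint_comp,
    ContinuousLinearMap.adjoint_adjoint]

theorem strongInner_smul_left (a : A.Elem) (x y : A.EllStrong) :
    strongInner (a • x) y = a * strongInner x y := by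
  apply Subtype.ext
  rw [MulMemClass.coe_mul, coe_strongInner, coe_strongInner, row_smul,
    ContinuousLinearMap.adjoint_comp, ContinuousLinearMap.star_eq_adjoint,
    ContinuousLinearMap.adjoint_adjoint, ContinuousLinearMap.mul_def,
    ContinuousLinearMap.comp_assoc]

theorem strongInner_csmul_left (c : ℂ) (x y : A.EllStrong) :
    strongInner (c • x) y = c • strongInner x y := by
  apply Subtype.ext
  rw [SetLike.val_smul, coe_strongInner, coe_strongInner, row_csmul, map_smulₛₗ,
    ContinuousLinearMap.smul_comp]
  simp

theorem strongInner_self_nonneg (x : A.EllStrong) : 0 ≤ strongInner x x := by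
  change (0 : H →L[ℂ] H) ≤ (strongInner x x : H →L[ℂ] H)
  rw [coe_strongInner, ContinuousLinearMap.nonneg_iff_isPositive]
  exact ContinuousLinearMap.isPositive_adjoint_comp_self _

theorem strongInner_self_eq_zero {x : A.EllStrong} : strongInner x x = 0 ↔ x = 0 := by
  rw [← norm_eq_zero (a := x), norm_def, Real.sqrt_eq_zero (norm_nonneg _), norm_eq_zero]

/-- `ℓ²_strong(A)` as an inner product module over `A`. -/
instance : CStarModule A.Elem A.EllStrong where
  inner x y := strongInner y x
  inner_add_right {_ _ _} := strongInner_add_left _ _ _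
  inner_self_nonneg := strongInner_self_nonneg _
  inner_self := strongInner_self_eq_zero
  inner_op_smul_right := strongInner_smul_left _ _ _
  inner_smul_right_complex := strongInner_csmul_left _ _ _
  star_inner x y := star_strongInner _ _
  norm_eq_sqrt_norm_inner_self _ := rfl

theorem inner_def (x y : A.EllStrong) : inner A.Elem x y = strongInner y x := rfl

/-- Auxiliary: the truncation `(x₀, …, x_{N-1}, 0, 0, …)`. -/
def trunc (x : ℕ → A.Elem) (N : ℕ) : A.EllStrong :=
  ⟨fun n => if n < N then x n else 0,
    ⟨∑ n ∈ Finset.range N, ‖x n * star (x n)‖, by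
      rintro _ ⟨M, rfl⟩
      refine (norm_sum_le _ _).trans ?_
      have h : ∀ n ∈ Finset.range (max M N) \ Finset.range N,
          ‖(if n < N then x n else 0) * star (if n < N then x n else 0)‖ = 0 := by
        intro n hn
        simp only [Finset.mem_sdiff, Finset.mem_range, not_lt] at hn
        simp [not_lt.mpr hn.2]
      calc ∑ n ∈ Finset.range M, ‖(if n < N then x n else 0) * star (if n < N then x n else 0)‖
          ≤ ∑ n ∈ Finset.range (max M N),
              ‖(if n < N then x n else 0) * star (if n < N then x n else 0)‖ :=
            Finset.sum_le_sum_of_subset_of_nonneg (by simp) fun _ _ _ => norm_nonneg _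
        _ = ∑ n ∈ Finset.range N,
              ‖(if n < N then x n else 0) * star (if n < N then x n else 0)‖ := by
            rw [← Finset.sum_sdiff (s₁ := Finset.range N) (by simp), Finset.sum_eq_zero h,
              zero_add]
        _ = ∑ n ∈ Finset.range N, ‖x n * star (x n)‖ :=
            Finset.sum_congr rfl fun n hn => by simp [Finset.mem_range.mp hn]⟩⟩

theorem trunc_apply (x : ℕ → A.Elem) (N n : ℕ) : trunc x N n = if n < N then x n else 0 := rfl

theorem strongInner_trunc_left (x : ℕ → A.Elem) (y : A.EllStrong) (N : ℕ) :
    strongInner (trunc x N) y = ∑ n ∈ Finset.range N, x n * star (y n) := by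
  apply Subtype.ext
  ext ξ
  refine tendsto_nhds_unique (tendsto_strongInner (trunc x N) y ξ) ?_
  refine tendsto_const_nhds.congr' ?_
  filter_upwards [eventually_ge_atTop N] with M hM
  congr 2
  rw [← Finset.sum_subset (Finset.range_mono hM)]
  · exact Finset.sum_congr rfl fun n hn => by simp [trunc_apply, Finset.mem_range.mp hn]
  · intro n _ hn
    simp only [Finset.mem_range] at hn
    simp [trunc_apply, hn]

theorem strongInner_trunc_self (x : ℕ → A.Elem) (N : ℕ) :
    strongInner (trunc x N) (trunc x N) = ∑ n ∈ Finset.range N, x n * star (x n) := by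
  rw [strongInner_trunc_left]
  exact Finset.sum_congr rfl fun n hn => by simp [trunc_apply, Finset.mem_range.mp hn]

theorem trunc_add (x y : ℕ → A.Elem) (N : ℕ) : trunc (x + y) N = trunc x N + trunc y N := by
  ext n : 1
  by_cases h : n < N <;> simp [trunc_apply, h]

theorem trunc_smul (a : A.Elem) (x : ℕ → A.Elem) (N : ℕ) : trunc (a • x) N = a • trunc x N := by
  ext n : 1
  by_cases h : n < N <;> simp [trunc_apply, h]

theorem norm_smul_le' (a : A.Elem) (x : A.EllStrong) : ‖a • x‖ ≤ ‖a‖ * ‖x‖ := by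
  rw [norm_eq_norm_row, norm_eq_norm_row, row_smul, mul_comm]
  refine (ContinuousLinearMap.opNorm_comp_le _ _).trans ?_
  rw [norm_star]; rfl

theorem tendsto_strongInner_of_trunc {x y : A.EllStrong}
    (hx : Tendsto (fun N => trunc x N) atTop (𝓝 x)) :
    Tendsto (fun N : ℕ => ∑ n ∈ Finset.range N, x n * star (y n)) atTop
      (𝓝 (strongInner x y)) := by
  rw [tendsto_iff_norm_sub_tendsto_zero] at hx ⊢
  refine squeeze_zero (fun _ => norm_nonneg _) (fun N => ?_)
    (by simpa using hx.mul_const ‖y‖)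
  rw [← strongInner_trunc_left]
  have : strongInner (trunc x N) y - strongInner x y = strongInner (trunc x N - x) y := by
    rw [sub_eq_iff_eq_add, ← strongInner_add_left, sub_add_cancel]
  rw [this]
  exact norm_strongInner_le _ _

theorem mem_strongSeq_of_tendsto {x : ℕ → A.Elem} {s : A.Elem}
    (h : Tendsto (fun N : ℕ => ∑ n ∈ Finset.range N, x n * star (x n)) atTop (𝓝 s)) :
    x ∈ A.strongSeq := h.norm.bddAbove_range

theorem tendsto_trunc {x : A.EllStrong} {s : A.Elem}
    (h : Tendsto (fun N : ℕ => ∑ n ∈ Finset.range N, x n * star (x n)) atTop (𝓝 s)) :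
    Tendsto (fun N => trunc x N) atTop (𝓝 x) := by
  have hs : strongInner x x = s := by
    apply Subtype.ext
    ext ξ
    refine tendsto_nhds_unique (tendsto_strongInner x x ξ) ?_
    have h1 := ((continuous_subtype_val (p := (· ∈ A.toStarSubalgebra))).tendsto s).comp h
    exact ((ContinuousLinearMap.apply ℂ H ξ).continuous.tendsto _).comp h1
  rw [tendsto_iff_norm_sub_tendsto_zero] at h ⊢
  have key : ∀ N, ‖trunc x N - x‖ = √‖∑ n ∈ Finset.range N, x n * star (x n) - s‖ := by
    intro N
    have e1 : strongInner x (trunc x N) = strongInner (trunc x N) (trunc x N) := by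
      rw [← star_strongInner, strongInner_trunc_left, strongInner_trunc_self]
      simp
    have e2 : strongInner (trunc x N) x = strongInner (trunc x N) (trunc x N) := by
      rw [strongInner_trunc_left, strongInner_trunc_self]
    have e3 : strongInner (trunc x N - x) (trunc x N - x) =
        -(∑ n ∈ Finset.range N, x n * star (x n) - s) := by
      rw [← inner_def, CStarModule.inner_sub_left, CStarModule.inner_sub_right,
        CStarModule.inner_sub_right]
      simp only [inner_def, e1, e2, hs, strongInner_trunc_self]
      abel
    rw [norm_def, e3, norm_neg]
  simp only [key]
  have h' := (Real.continuous_sqrt.tendsto 0).comp h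
  rw [Real.sqrt_zero] at h'
  exact h'

end EllStrong

/-! ### The standard Hilbert module `ℓ²(A)` -/

/-- The sequences `(aₙ)` in `A` such that `∑ aₙ aₙ*` converges in norm in `A`, as a left
`A`-submodule of the module of all sequences. -/
def normSeq : Submodule A.Elem (ℕ → A.Elem) where
  carrier := {a | ∃ s : A.Elem,
    Tendsto (fun N : ℕ => ∑ n ∈ Finset.range N, a n * star (a n)) atTop (𝓝 s)}
  zero_mem' := ⟨0, by simp⟩
  add_mem' := by
    rintro x y ⟨s, hs⟩ ⟨t, ht⟩
    let x' : A.EllStrong := ⟨x, EllStrong.mem_strongSeq_of_tendsto hs⟩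
    let y' : A.EllStrong := ⟨y, EllStrong.mem_strongSeq_of_tendsto ht⟩
    have h := (EllStrong.tendsto_trunc (x := x') hs).add (EllStrong.tendsto_trunc (x := y') ht)
    simp only [← EllStrong.trunc_add] at h
    exact ⟨_, EllStrong.tendsto_strongInner_of_trunc (x := x' + y') (y := x' + y') h⟩
  smul_mem' := by
    rintro a x ⟨s, hs⟩
    refine ⟨a * s * star a, ?_⟩
    convert ((hs.const_mul a).mul_const (star a)) using 2 with N
    simp [Finset.mul_sum, Finset.sum_mul, mul_assoc]

/-- `ℓ²(A)`, the type of all sequences `(aₙ)` in `A` such that `∑ aₙ aₙ*` converges in norm. -/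
def Ell : Type _ := ↥A.normSeq

namespace Ell

instance : AddCommGroup A.Ell := inferInstanceAs (AddCommGroup ↥A.normSeq)
instance : Module A.Elem A.Ell := inferInstanceAs (Module A.Elem ↥A.normSeq)
instance : Module ℂ A.Ell := inferInstanceAs (Module ℂ ↥A.normSeq)

variable {A}

/-- The underlying sequence; `a n` is its `n`-th term. -/
def seq (a : A.Ell) : ℕ → A.Elem := Subtype.val (p := (· ∈ A.normSeq)) a

instance : CoeFun A.Ell (fun _ => ℕ → A.Elem) := ⟨seq⟩

theorem exists_norm_sum_self (a : A.Ell) : ∃ s : A.Elem,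
    Tendsto (fun N : ℕ => ∑ n ∈ Finset.range N, a n * star (a n)) atTop (𝓝 s) :=
  Subtype.property (p := (· ∈ A.normSeq)) a

/-- The inclusion `ℓ²(A) ⊆ ℓ²_strong(A)`: the same sequence, in the larger space. -/
def toStrong (a : A.Ell) : A.EllStrong :=
  ⟨a.seq, EllStrong.mem_strongSeq_of_tendsto a.exists_norm_sum_self.choose_spec⟩

@[simp] theorem toStrong_apply (a : A.Ell) (n : ℕ) : a.toStrong n = a n := rfl

theorem toStrong_injective : Function.Injective (toStrong (A := A)) :=
  fun _ _ h => Subtype.ext (congrArg EllStrong.seq h)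

theorem tendsto_trunc (a : A.Ell) :
    Tendsto (fun N => EllStrong.trunc a N) atTop (𝓝 a.toStrong) :=
  EllStrong.tendsto_trunc (x := a.toStrong) a.exists_norm_sum_self.choose_spec

/-- For `a, b ∈ ℓ²(A)` the series `∑ aₙ bₙ*` converges in norm in `A`. -/
theorem exists_norm_sum (a b : A.Ell) : ∃ s : A.Elem,
    Tendsto (fun N : ℕ => ∑ n ∈ Finset.range N, a n * star (b n)) atTop (𝓝 s) :=
  ⟨EllStrong.strongInner a.toStrong b.toStrong,
    EllStrong.tendsto_strongInner_of_trunc (x := a.toStrong) (y := b.toStrong) a.tendsto_trunc⟩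

/-- `⟨a, b⟩ = ∑ aₙ bₙ*`, the limit in norm of the partial sums. It is linear in `a` and antilinear
in `b`. -/
def normInner (a b : A.Ell) : A.Elem := (exists_norm_sum a b).choose

theorem tendsto_normInner (a b : A.Ell) :
    Tendsto (fun N : ℕ => ∑ n ∈ Finset.range N, a n * star (b n)) atTop (𝓝 (normInner a b)) :=
  (exists_norm_sum a b).choose_spec

theorem normInner_eq (a b : A.Ell) :
    normInner a b = EllStrong.strongInner a.toStrong b.toStrong :=
  tendsto_nhds_unique (tendsto_normInner a b)
    (EllStrong.tendsto_strongInner_of_trunc (x := a.toStrong) (y := b.toStrong) a.tendsto_trunc)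

/-- The norm `‖a‖ = ‖⟨a, a⟩‖^{1/2}`. -/
instance : Norm A.Ell := ⟨fun a => √‖normInner a a‖⟩

theorem norm_def (a : A.Ell) : ‖a‖ = √‖normInner a a‖ := rfl

theorem norm_toStrong (a : A.Ell) : ‖a.toStrong‖ = ‖a‖ := by
  rw [norm_def, normInner_eq, EllStrong.norm_def]

theorem normedSpaceCore : NormedSpace.Core ℂ A.Ell where
  norm_nonneg _ := Real.sqrt_nonneg _
  norm_eq_zero_iff a := by
    rw [← norm_toStrong, norm_eq_zero]
    exact ⟨fun h => toStrong_injective h, fun h => congrArg toStrong h⟩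
  norm_smul c a := by
    rw [← norm_toStrong, ← norm_toStrong, ← norm_smul]; rfl
  norm_triangle a b := by
    rw [← norm_toStrong, ← norm_toStrong, ← norm_toStrong]
    exact norm_add_le a.toStrong b.toStrong

instance : NormedAddCommGroup A.Ell := NormedAddCommGroup.ofCore normedSpaceCore
instance : NormedSpace ℂ A.Ell := NormedSpace.ofCore normedSpaceCore

/-- `ℓ²(A)` as an inner product module over `A`. -/
instance : CStarModule A.Elem A.Ell where
  inner x y := normInner y x
  inner_add_right {x y z} := by
    simp only [normInner_eq]
    exact EllStrong.strongInner_add_left y.toStrong z.toStrong x.toStrong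
  inner_self_nonneg {x} := by
    rw [normInner_eq]; exact EllStrong.strongInner_self_nonneg _
  inner_self {x} := by
    rw [← norm_eq_zero (a := x), norm_def, Real.sqrt_eq_zero (norm_nonneg _), norm_eq_zero]
  inner_op_smul_right {a x y} := by
    simp only [normInner_eq]
    exact EllStrong.strongInner_smul_left a y.toStrong x.toStrong
  inner_smul_right_complex {c x y} := by
    simp only [normInner_eq]
    exact EllStrong.strongInner_csmul_left c y.toStrong x.toStrong
  star_inner x y := by
    simp only [normInner_eq]
    exact EllStrong.star_strongInner _ _
  norm_eq_sqrt_norm_inner_self _ := rfl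

end Ell

end VonNeumannAlgebra

end

/-! Every element of `ℓ²(A)` is the norm limit of its truncations, so a bounded module map `L` on
`ℓ²(A)` is determined by its values on the unit vectors `eₙ`. With `tₙ = L(eₙ)*`, testing `L` on the
truncation `t_N` of `t` gives `‖t_N‖² = ‖L t_N‖ ≤ ‖L‖ ‖t_N‖`, hence `‖t_N‖ ≤ ‖L‖` for all `N`. Thus
`t` lies in `ℓ²_strong(A)` and represents `L`; the same test together with Cauchy–Schwarz shows that
`t ↦ ⟨·, t⟩` is isometric (`norm_toDual`, `toDual_surjective`). Completeness of `ℓ²_strong(A)` is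
inherited from the dual.

For self-duality, restrict `L` to `ℓ²(A)` and represent the restriction by `t`. Then `L - ⟨·, t⟩`
vanishes on all truncations, but these need not converge in norm in `ℓ²_strong(A)`. The inequality
`L(x) L(x)* ≤ ‖L‖² ⟨x, x⟩` (`norm_star_map_apply_le`) replaces density: the tails satisfy `⟨x - x_N,
x - x_N⟩ → 0` strongly, which forces `L(x)* ξ = ⟨x, t⟩* ξ` for every vector `ξ`. -/

namespace VonNeumannAlgebra

variable {H : Type*} [NormedAddCommGroup H] [InnerProductSpace ℂ H] [CompleteSpace H]
variable {A : VonNeumannAlgebra H}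

/-! ### Norm closedness of `A` and inverse square roots in `A`. -/

theorem isClosed_coe : IsClosed (A.toStarSubalgebra : Set (H →L[ℂ] H)) := by
  have h : (A.toStarSubalgebra : Set (H →L[ℂ] H)) =
      Set.centralizer (Set.centralizer (A : Set (H →L[ℂ] H))) := by
    rw [A.centralizer_centralizer]; rfl
  rw [h]
  exact Set.isClosed_centralizer _

instance : CompleteSpace A.Elem := isClosed_coe.completeSpace_coe

/-- An element of `B(H)` commuting with everything that a given element of `A` commutes with lies
in `A`. -/
theorem mem_of_forall_commute {T a : H →L[ℂ] H} (hT : T ∈ A.toStarSubalgebra)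
    (h : ∀ g, Commute g T → Commute g a) : a ∈ A.toStarSubalgebra := by
  rw [mem_carrier, ← A.centralizer_centralizer, Set.mem_centralizer_iff]
  intro g hg
  rw [Set.mem_centralizer_iff] at hg
  exact h g (hg T hT).symm

/-- A positive element `T` of `A` perturbed by `ε > 0` has a selfadjoint square root `b` in `B(H)`
whose inverse is a selfadjoint element `a` of `A`. -/
theorem exists_sqrt_add_inverse {T : H →L[ℂ] H} (hT : T ∈ A.toStarSubalgebra) (h0 : 0 ≤ T)
    {ε : ℝ} (hε : 0 < ε) : ∃ (a : A.Elem) (b : H →L[ℂ] H),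
      star (a : H →L[ℂ] H) = a ∧ star b = b ∧ (a : H →L[ℂ] H) * b = 1 ∧
        b * (a : H →L[ℂ] H) = 1 ∧ b * b = T + algebraMap ℝ (H →L[ℂ] H) ε := by
  have hε' : (0 : H →L[ℂ] H) ≤ algebraMap ℝ (H →L[ℂ] H) ε :=
    algebraMap_nonneg _ hε.le
  set S : H →L[ℂ] H := T + algebraMap ℝ (H →L[ℂ] H) ε with hS
  have hS0 : 0 ≤ S := add_nonneg h0 hε'
  have hSu : IsUnit S := by
    have h1 : IsUnit (algebraMap ℝ (H →L[ℂ] H) ε) :=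
      (IsUnit.mk0 ε hε.ne').map (algebraMap ℝ (H →L[ℂ] H))
    -- `S ≥ ε · 1`, so `S` is invertible even when `T` is not.
    exact CStarAlgebra.isUnit_of_le _ (le_add_of_nonneg_left h0) (h1.isStrictlyPositive hε')
  set b := CFC.sqrt S with hb
  have hbb : b * b = S := CFC.sqrt_mul_sqrt_self S hS0
  have hbu : IsUnit b := by
    rw [← hbb] at hSu
    exact ((Commute.refl b).isUnit_mul_iff.mp hSu).1
  have hbs : star b = b := (IsSelfAdjoint.of_nonneg (CFC.sqrt_nonneg S)).star_eq
  obtain ⟨u, hu⟩ := hbu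
  have hab : (↑u⁻¹ : H →L[ℂ] H) * b = 1 := by rw [← hu]; exact u.inv_mul
  have hba : b * (↑u⁻¹ : H →L[ℂ] H) = 1 := by rw [← hu]; exact u.mul_inv
  refine ⟨⟨↑u⁻¹, mem_of_forall_commute hT fun g hg => ?_⟩, b, ?_, hbs, hab, hba, hbb⟩
  -- Commutation with `T` passes to `S`, to its square root by functional calculus, and then to the
  -- inverse; the bicommutant theorem puts the inverse in `A`.
  · have hgS : Commute S g := (hg.add_right (Algebra.commutes' ε g).symm).symm
    have hgb : Commute b g := hgS.cfcₙ_nnreal NNReal.sqrt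
    rw [← hu] at hgb
    exact hgb.symm.units_inv_right
  · have h2 : b * star (↑u⁻¹ : H →L[ℂ] H) = 1 := by
      have := congrArg star hab
      rwa [star_mul, hbs, star_one] at this
    exact (left_inv_eq_right_inv hab h2).symm

/-! ### Truncations and the module inequality in `ℓ²_strong(A)`. -/

namespace EllStrong

theorem norm_sq_eq (x : A.EllStrong) : ‖x‖ ^ 2 = ‖strongInner x x‖ := by
  rw [norm_def, Real.sq_sqrt (norm_nonneg _)]

theorem norm_row_sq (x : A.EllStrong) (ξ : H) :
    ‖row x ξ‖ ^ 2 = RCLike.re (inner ℂ ξ ((strongInner x x : H →L[ℂ] H) ξ)) := by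
  rw [coe_strongInner, ContinuousLinearMap.comp_apply, ContinuousLinearMap.adjoint_inner_right,
    inner_self_eq_norm_sq]

theorem norm_trunc_sq (x : ℕ → A.Elem) (N : ℕ) :
    ‖trunc x N‖ ^ 2 = ‖∑ n ∈ Finset.range N, x n * star (x n)‖ := by
  rw [norm_sq_eq, strongInner_trunc_self]

theorem mem_strongSeq_of_norm_trunc_le {x : ℕ → A.Elem} {C : ℝ} (h : ∀ N, ‖trunc x N‖ ≤ C) :
    x ∈ A.strongSeq := by
  refine ⟨C ^ 2, ?_⟩
  rintro _ ⟨N, rfl⟩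
  simp only [← norm_trunc_sq]
  gcongr
  exact h N

/-- The operator norm is lower semicontinuous under strong limits, and `⟨x, x⟩` is the strong limit
of its partial sums. -/
theorem norm_le_of_norm_trunc_le {x : A.EllStrong} {C : ℝ} (h : ∀ N, ‖trunc x N‖ ≤ C) :
    ‖x‖ ≤ C := by
  refine le_of_sq_le_sq ?_ ((norm_nonneg _).trans (h 0))
  rw [norm_sq_eq, ← norm_coe]
  refine ContinuousLinearMap.opNorm_le_bound _ (sq_nonneg C) fun ξ => ?_
  refine le_of_tendsto' (tendsto_strongInner x x ξ).norm fun N => ?_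
  refine (ContinuousLinearMap.le_opNorm _ _).trans ?_
  gcongr
  rw [norm_coe, ← norm_trunc_sq]
  gcongr
  exact h N

theorem inner_trunc_comm (x : A.EllStrong) (N : ℕ) :
    strongInner x (trunc x N) = strongInner (trunc x N) x := by
  rw [← star_strongInner, strongInner_trunc_left]
  simp

/-- The substitute for norm convergence of truncations: `⟨x - x_N, x - x_N⟩` is exactly the tail of
the strongly convergent series for `⟨x, x⟩`. -/
theorem tendsto_strongInner_sub_trunc (x : A.EllStrong) (ξ : H) :
    Tendsto (fun N => (strongInner (x - trunc x N) (x - trunc x N) : H →L[ℂ] H) ξ) atTop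
      (𝓝 0) := by
  have key : ∀ N, strongInner (x - trunc x N) (x - trunc x N) =
      strongInner x x - ∑ n ∈ Finset.range N, x n * star (x n) := by
    intro N
    rw [← inner_def, CStarModule.inner_sub_left, CStarModule.inner_sub_right,
      CStarModule.inner_sub_right]
    simp only [inner_def, inner_trunc_comm, strongInner_trunc_self]
    rw [strongInner_trunc_left]
    abel
  have h := (tendsto_const_nhds (x := (strongInner x x : H →L[ℂ] H) ξ)).sub
    (tendsto_strongInner x x ξ)
  rw [sub_self] at h
  refine h.congr fun N => ?_
  rw [key]
  rfl

theorem norm_sqrt_apply_sq (x : A.EllStrong) {ε : ℝ} {b : H →L[ℂ] H} (hb : star b = b)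
    (hbb : b * b = (strongInner x x : H →L[ℂ] H) + algebraMap ℝ (H →L[ℂ] H) ε) (ξ : H) :
    ‖b ξ‖ ^ 2 = ‖row x ξ‖ ^ 2 + ε * ‖ξ‖ ^ 2 := by
  have h1 : ‖b ξ‖ ^ 2 = RCLike.re (inner ℂ ξ ((b * b) ξ)) := by
    nth_rewrite 2 [← hb]
    rw [ContinuousLinearMap.star_eq_adjoint, _root_.mul_apply_eq_comp,
      ContinuousLinearMap.adjoint_inner_right, inner_self_eq_norm_sq]
  rw [h1, hbb, norm_row_sq, _root_.add_apply, inner_add_right, map_add]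
  congr 1
  rw [Algebra.algebraMap_eq_smul_one, _root_.smul_apply, ← Complex.coe_smul,
    inner_smul_right]
  change RCLike.re ((ε : ℂ) * inner ℂ ξ ξ) = _
  simp [inner_self_eq_norm_sq_to_K, ← Complex.ofReal_pow]

/-- The module inequality `L(x) L(x)* ≤ ‖L‖² ⟨x, x⟩`, evaluated at a vector. -/
theorem norm_star_map_apply_le {L : A.EllStrong →L[ℂ] A.Elem}
    (hL : L ∈ CStarDual A.Elem A.EllStrong) (x : A.EllStrong) (ξ : H) :
    ‖star (L x : H →L[ℂ] H) ξ‖ ≤ ‖L‖ * ‖row x ξ‖ := by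
  have key : ∀ ε : ℝ, 0 < ε →
      ‖star (L x : H →L[ℂ] H) ξ‖ ≤ ‖L‖ * √(‖row x ξ‖ ^ 2 + ε * ‖ξ‖ ^ 2) := by
    intro ε hε
    obtain ⟨a, b, ha, hb, hab, hba, hbb⟩ := exists_sqrt_add_inverse (strongInner x x).2
      (strongInner_self_nonneg x) hε
    -- With `a = (⟨x, x⟩ + ε)^(-1/2)`, the vector `x` is normalised: `‖row x (a η)‖ ≤ ‖b (a η)‖ =
    -- ‖η‖`.
    have hax : ‖a • x‖ ≤ 1 := by
      rw [norm_eq_norm_row, row_smul, ha]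
      refine ContinuousLinearMap.opNorm_le_bound _ zero_le_one fun η => ?_
      rw [one_mul]
      refine le_of_sq_le_sq ?_ (norm_nonneg _)
      have h1 : b ((a : H →L[ℂ] H) η) = η := congrArg (fun T : H →L[ℂ] H => T η) hba
      have h2 := norm_sqrt_apply_sq x hb hbb ((a : H →L[ℂ] H) η)
      rw [h1] at h2
      rw [ContinuousLinearMap.comp_apply, h2]
      have : 0 ≤ ε * ‖(a : H →L[ℂ] H) η‖ ^ 2 := by positivity
      linarith
    -- Writing `ξ = a (b ξ)` moves `a` into the argument of `L`, where `‖L (a • x)‖ ≤ ‖L‖`.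
    have h1 : star (L x : H →L[ℂ] H) ξ = star ((a * L x : A.Elem) : H →L[ℂ] H) (b ξ) := by
      have h2 : (a : H →L[ℂ] H) (b ξ) = ξ := congrArg (fun T : H →L[ℂ] H => T ξ) hab
      rw [MulMemClass.coe_mul, star_mul, ha, _root_.mul_apply_eq_comp, h2]
    rw [h1, ← norm_sqrt_apply_sq x hb hbb ξ, Real.sqrt_sq (norm_nonneg _), ← hL a x]
    refine (ContinuousLinearMap.le_opNorm _ _).trans ?_
    gcongr
    rw [norm_star, norm_coe]
    exact (L.le_opNorm _).trans (mul_le_of_le_one_right (norm_nonneg _) hax)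
  -- The bound is continuous in `ε`, so the regularisation is removed by `ε → 0`.
  have hc : Tendsto (fun ε : ℝ => ‖L‖ * √(‖row x ξ‖ ^ 2 + ε * ‖ξ‖ ^ 2)) (𝓝[>] 0)
      (𝓝 (‖L‖ * ‖row x ξ‖)) := by
    have : Continuous (fun ε : ℝ => ‖L‖ * √(‖row x ξ‖ ^ 2 + ε * ‖ξ‖ ^ 2)) := by fun_prop
    have h := this.tendsto 0
    simp only [zero_mul, add_zero, Real.sqrt_sq (norm_nonneg _)] at h
    exact h.mono_left nhdsWithin_le_nhds
  exact ge_of_tendsto hc (eventually_mem_nhdsWithin.mono key)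

/-- A bounded module map vanishing on all truncations vanishes. -/
theorem eq_zero_of_map_trunc_eq_zero {L : A.EllStrong →L[ℂ] A.Elem}
    (hL : L ∈ CStarDual A.Elem A.EllStrong) {x : A.EllStrong} (h : ∀ N, L (trunc x N) = 0) :
    L x = 0 := by
  -- The module inequality controls `L(x)*` on vectors, and `L x = L (x - x_N)` for every `N`.
  rw [← star_eq_zero]
  apply Subtype.ext
  ext ξ
  change star (L x : H →L[ℂ] H) ξ = 0
  rw [← norm_le_zero_iff]
  have hlim : Tendsto (fun N => ‖row (x - trunc x N) ξ‖) atTop (𝓝 0) := by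
    have h1 : Tendsto (fun N => ‖row (x - trunc x N) ξ‖ ^ 2) atTop (𝓝 0) := by
      simp only [norm_row_sq]
      have := (tendsto_const_nhds (x := ξ)).inner (𝕜 := ℂ) (tendsto_strongInner_sub_trunc x ξ)
      rw [inner_zero_right] at this
      simpa [Function.comp_def] using (RCLike.continuous_re.tendsto (0 : ℂ)).comp this
    simpa [Real.sqrt_sq, Function.comp_def] using (Real.continuous_sqrt.tendsto 0).comp h1
  refine ge_of_tendsto' (by simpa using hlim.const_mul ‖L‖) fun N => ?_
  have := norm_star_map_apply_le hL (x - trunc x N) ξ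
  rwa [map_sub, h N, sub_zero] at this

end EllStrong

/-! ### Truncations and unit vectors in `ℓ²(A)`. -/

namespace Ell

/-- The truncation `(x₀, …, x_{N-1}, 0, 0, …)` as an element of `ℓ²(A)`. -/
noncomputable def trunc (x : ℕ → A.Elem) (N : ℕ) : A.Ell :=
  ⟨fun n => if n < N then x n else 0, ∑ n ∈ Finset.range N, x n * star (x n), by
    refine tendsto_const_nhds.congr' ?_
    filter_upwards [eventually_ge_atTop N] with M hM
    rw [← Finset.sum_subset (Finset.range_mono hM)]
    · exact Finset.sum_congr rfl fun n hn => by simp [Finset.mem_range.mp hn]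
    · intro n _ hn
      simp only [Finset.mem_range] at hn
      simp [hn]⟩

theorem toStrong_trunc (x : ℕ → A.Elem) (N : ℕ) : (trunc x N).toStrong = EllStrong.trunc x N :=
  rfl

theorem norm_trunc (x : ℕ → A.Elem) (N : ℕ) : ‖trunc x N‖ = ‖EllStrong.trunc x N‖ := by
  rw [← norm_toStrong, toStrong_trunc]

theorem norm_trunc_sq (x : ℕ → A.Elem) (N : ℕ) :
    ‖trunc x N‖ ^ 2 = ‖∑ n ∈ Finset.range N, x n * star (x n)‖ := by
  rw [norm_trunc, EllStrong.norm_trunc_sq]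

/-- The inclusion of `ℓ²(A)` in `ℓ²_strong(A)` as a linear isometry. -/
noncomputable def toStrongₗᵢ : A.Ell →ₗᵢ[ℂ] A.EllStrong where
  toFun := toStrong
  map_add' _ _ := rfl
  map_smul' _ _ := rfl
  norm_map' := norm_toStrong

theorem tendsto_trunc_self (a : A.Ell) : Tendsto (fun N => trunc a N) atTop (𝓝 a) :=
  (toStrongₗᵢ (A := A)).isometry.isEmbedding.tendsto_nhds_iff.mpr a.tendsto_trunc

/-- The unit vector `eₙ` is encoded as `trunc (Pi.single n 1) (n + 1)`, with `n + 1` the least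
length that keeps the entry at `n`; the formula is then module linearity. -/
theorem map_trunc {L : A.Ell →L[ℂ] A.Elem} (hL : L ∈ CStarDual A.Elem A.Ell) (x : ℕ → A.Elem)
    (N : ℕ) : L (trunc x N) =
      ∑ n ∈ Finset.range N, x n * L (trunc (Pi.single n 1) (n + 1)) := by
  induction N with
  | zero =>
    rw [Finset.sum_range_zero, ← map_zero L]
    congr 1
  | succ N ih =>
    rw [Finset.sum_range_succ, ← ih, ← hL, ← map_add]
    congr 1
    apply toStrong_injective
    change _ = EllStrong.trunc x N + x N • EllStrong.trunc (Pi.single N 1) (N + 1)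
    ext n : 1
    rw [toStrong_trunc]
    simp only [EllStrong.trunc_apply, EllStrong.add_apply, EllStrong.smul_apply]
    rcases lt_trichotomy n N with h | rfl | h
    · simp [h, h.ne, h.trans (Nat.lt_succ_self N)]
    · simp
    · simp [h.not_gt, not_lt.mpr (Nat.succ_le_of_lt h)]

/-- If `L (∑_{n<N} tₙ eₙ) = ∑_{n<N} tₙ tₙ*` then `‖∑_{n<N} tₙ eₙ‖ ≤ ‖L‖`. -/
theorem norm_trunc_le {L : A.Ell →L[ℂ] A.Elem} {t : ℕ → A.Elem} {N : ℕ}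
    (h : L (trunc t N) = ∑ n ∈ Finset.range N, t n * star (t n)) :
    ‖EllStrong.trunc t N‖ ≤ ‖L‖ := by
  have h1 := L.le_opNorm (trunc t N)
  rw [h, ← norm_trunc_sq, norm_trunc] at h1
  -- From `‖t_N‖² ≤ ‖L‖ ‖t_N‖` one cancels a factor; under the negation `‖t_N‖ > ‖L‖ ≥ 0`, so the
  -- case `t_N = 0` needs no separate treatment.
  by_contra! hlt
  nlinarith [norm_nonneg L]

end Ell

/-! ### The isometric isomorphism of `ℓ²_strong(A)` with `ℓ²(A)'`. -/

namespace EllStrong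

/-- The bounded module map `a ↦ ⟨a, t⟩` on `ℓ²(A)`. -/
noncomputable def toDual (t : A.EllStrong) : CStarDual A.Elem A.Ell :=
  ⟨LinearMap.mkContinuous
    { toFun := fun a => strongInner a.toStrong t
      map_add' := fun a b => strongInner_add_left a.toStrong b.toStrong t
      map_smul' := fun c a => strongInner_csmul_left c a.toStrong t } ‖t‖ fun a => by
        rw [mul_comm, ← Ell.norm_toStrong]
        exact norm_strongInner_le _ _,
    fun b a => strongInner_smul_left b a.toStrong t⟩

theorem toDual_apply (t : A.EllStrong) (a : A.Ell) :
    (toDual t).1 a = strongInner a.toStrong t := rfl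

theorem toDual_trunc (t : A.EllStrong) (x : ℕ → A.Elem) (N : ℕ) :
    (toDual t).1 (Ell.trunc x N) = ∑ n ∈ Finset.range N, x n * star (t n) := by
  rw [toDual_apply, Ell.toStrong_trunc, strongInner_trunc_left]

theorem norm_toDual (t : A.EllStrong) : ‖toDual t‖ = ‖t‖ := by
  refine le_antisymm (ContinuousLinearMap.opNorm_le_bound _ (norm_nonneg t) fun a => ?_) ?_
  · change ‖strongInner a.toStrong t‖ ≤ _
    rw [mul_comm, ← Ell.norm_toStrong]
    exact norm_strongInner_le _ _
  -- `t` itself need not lie in `ℓ²(A)`, so the functional is tested on its truncations.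
  exact norm_le_of_norm_trunc_le fun N => Ell.norm_trunc_le (toDual_trunc t t N)

/-- The antilinear isometry `t ↦ (a ↦ ⟨a, t⟩)` from `ℓ²_strong(A)` to `ℓ²(A)'`. -/
noncomputable def toDualₗᵢ : A.EllStrong →ₗᵢ⋆[ℂ] CStarDual A.Elem A.Ell where
  toFun := toDual
  map_add' s t := by
    apply Subtype.ext
    ext1 a
    exact CStarModule.inner_add_left (A := A.Elem) (x := s) (y := t) (z := a.toStrong)
  map_smul' c t := by
    apply Subtype.ext
    ext1 a
    exact CStarModule.inner_smul_left_complex (A := A.Elem) (z := c) (x := t) (y := a.toStrong)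
  norm_map' := norm_toDual

theorem toDual_surjective : Function.Surjective (toDual (A := A)) := by
  rintro ⟨L, hL⟩
  let t : ℕ → A.Elem := fun n => star (L (Ell.trunc (Pi.single n 1) (n + 1)))
  have hLt (x : ℕ → A.Elem) (N : ℕ) :
      L (Ell.trunc x N) = ∑ n ∈ Finset.range N, x n * star (t n) := by
    rw [Ell.map_trunc hL]
    simp [t]
  have ht : t ∈ A.strongSeq :=
    mem_strongSeq_of_norm_trunc_le fun N => Ell.norm_trunc_le (hLt t N)
  refine ⟨⟨t, ht⟩, Subtype.ext (ContinuousLinearMap.ext fun a => ?_)⟩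
  -- Both functionals are continuous and agree on truncations, which converge to `a` in norm in
  -- `ℓ²(A)`.
  refine tendsto_nhds_unique (((toDual _).1.continuous.tendsto a).comp a.tendsto_trunc_self) ?_
  refine ((L.continuous.tendsto a).comp a.tendsto_trunc_self).congr fun N => ?_
  exact (hLt a N).trans (toDual_trunc (⟨t, ht⟩ : A.EllStrong) a N).symm

/-- The antilinear isometric isomorphism of `ℓ²_strong(A)` onto `ℓ²(A)'`. -/
noncomputable def dualEquiv : A.EllStrong ≃ₗᵢ⋆[ℂ] CStarDual A.Elem A.Ell :=
  LinearIsometryEquiv.ofSurjective toDualₗᵢ toDual_surjective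

end EllStrong

/-! ### Completeness and self-duality of `ℓ²_strong(A)`. -/

theorem isClosed_cstarDual {B E : Type*} [NormedRing B] [NormedAlgebra ℂ B]
    [NormedAddCommGroup E] [NormedSpace ℂ E] [Module B E] :
    IsClosed (CStarDual B E : Set (E →L[ℂ] B)) := by
  have h : (CStarDual B E : Set (E →L[ℂ] B)) =
      ⋂ (a : B) (x : E), {L | L (a • x) = a * L x} := by
    ext L
    simp [CStarDual]
  rw [h]
  refine isClosed_iInter fun a => isClosed_iInter fun x => isClosed_eq ?_ ?_
  · exact (ContinuousLinearMap.apply ℂ B (a • x)).continuous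
  · exact continuous_const.mul (ContinuousLinearMap.apply ℂ B x).continuous

namespace EllStrong

instance : CompleteSpace A.EllStrong := by
  have : CompleteSpace (CStarDual A.Elem A.Ell) := isClosed_cstarDual.completeSpace_coe
  exact (completeSpace_congr (e := (dualEquiv (A := A)).toEquiv)
    dualEquiv.isometry.isUniformEmbedding).mpr this

theorem isSelfDualModule : IsSelfDualModule A.Elem A.EllStrong := by
  intro L hL
  let M : CStarDual A.Elem A.Ell :=
    ⟨L.comp Ell.toStrongₗᵢ.toContinuousLinearMap, fun a x => hL a x.toStrong⟩
  obtain ⟨t, ht⟩ := toDual_surjective M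
  let I : A.EllStrong →L[ℂ] A.Elem := LinearMap.mkContinuous
    { toFun := fun y => strongInner y t
      map_add' := fun x y => strongInner_add_left x y t
      map_smul' := fun c x => strongInner_csmul_left c x t } ‖t‖ fun x => by
        rw [mul_comm]
        exact norm_strongInner_le _ _
  have hI : I ∈ CStarDual A.Elem A.EllStrong := fun a x => strongInner_smul_left a x t
  refine ⟨t, fun y => sub_eq_zero.mp ?_⟩
  refine eq_zero_of_map_trunc_eq_zero (L := L - I) (sub_mem hL hI) fun N => sub_eq_zero.mpr ?_
  -- `Ell.trunc y N` is sent by `toStrong` to the truncation of `y` definitionally, so evaluating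
  -- `ht` there is the required equality.
  exact (congrArg (fun M : CStarDual A.Elem A.Ell => M.1 (Ell.trunc y N)) ht).symm

end EllStrong

end VonNeumannAlgebra

theorem corollary2p5 {H : Type*} [NormedAddCommGroup H] [InnerProductSpace ℂ H] [CompleteSpace H]
    (A : VonNeumannAlgebra H) :
    -- the inner product of `ℓ²_strong(A)` is `⟨x, y⟩ = (strong) ∑ xₙ yₙ*`
    (∀ (x y : A.EllStrong) (ξ : H),
      Tendsto (fun N : ℕ => ((∑ n ∈ Finset.range N, x n * star (y n) : A.Elem) : H →L[ℂ] H) ξ)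
        atTop (𝓝 ((inner A.Elem y x : H →L[ℂ] H) ξ))) ∧
    -- `ℓ²_strong(A)` is a Hilbert `A`-module: it is complete
    CompleteSpace A.EllStrong ∧
    -- it contains `ℓ²(A)`, and its inner product extends that of `ℓ²(A)`
    (∀ a b : A.Ell, inner A.Elem a.toStrong b.toStrong = inner A.Elem a b) ∧
    -- `t ↦ (a ↦ ∑ aₙ tₙ* = ⟨a, t⟩)` is an antilinear isometric isomorphism onto `ℓ²(A)'`
    (∃ φ : A.EllStrong ≃ₗᵢ⋆[ℂ] CStarDual A.Elem A.Ell,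
      (∀ (t : A.EllStrong) (a : A.Ell),
        Tendsto (fun N : ℕ => ∑ n ∈ Finset.range N, a n * star (t n)) atTop (𝓝 ((φ t).1 a)) ∧
        (φ t).1 a = inner A.Elem t a.toStrong) ∧
      (∀ (b : A.Elem) (t : A.EllStrong) (a : A.Ell), (φ (b • t)).1 a = (φ t).1 a * star b) ∧
      (∀ a b : A.Ell, (φ b.toStrong).1 a = inner A.Elem b a)) ∧
    -- `ℓ²_strong(A)` is self-dual
    IsSelfDualModule A.Elem A.EllStrong := by
  refine ⟨VonNeumannAlgebra.EllStrong.tendsto_strongInner, inferInstance,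
    -- The arguments are swapped because `inner` is linear in its second variable, `normInner` in
    -- its first.
    fun a b => (VonNeumannAlgebra.Ell.normInner_eq b a).symm,
    ⟨VonNeumannAlgebra.EllStrong.dualEquiv, fun t a => ⟨?_, rfl⟩, fun b t a => ?_,
      fun a b => (VonNeumannAlgebra.Ell.normInner_eq a b).symm⟩,
    VonNeumannAlgebra.EllStrong.isSelfDualModule⟩
  · exact VonNeumannAlgebra.EllStrong.tendsto_strongInner_of_trunc (x := a.toStrong) (y := t)
      a.tendsto_trunc
  · exact CStarModule.inner_op_smul_left (A := A.Elem) (x := t) (y := a.toStrong) (a := b)
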